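/- Let $n\ge 1$ and $[n]=\{1,\dots,n\}$. Let $R_n$ be the free commutative unital $\mathbb C$-algebra (polynomial ring) on the nonempty subsets of $[n]$, let $A_n\subseteq R_n$ be the subalgebra generated by the size-two subsets of $[n]$, and let $M_n=A_n/I_n$, where $I_n$ is the ideal generated by the elements $\{a,b\}\cdot\{a,b\}$, $\{a,b\}\cdot\{a,c\}$ and $\{a,b\}\cdot\{c,d\}+\{a,c\}\cdot\{b,d\}+\{a,d\}\cdot\{b,c\}$ for all distinct $a,b,c,d\in[n]$ (in each case, those that occur). Let $q:A_n\to M_n$ be the quotient map, let $g_n:R_n\to A_n$ be the $\mathbb C$-algebra map with $g_n(B)=\sum_{\{a,b\}\subseteq B}\{a,b\}$ (sum over the size-two subsets of $B$) for every generator $B$, and let $h_n=q\circ g_n$. Let $\Pi(n)_0$ be the set of set partitions of $[n]$ without singleton blocks, and $\iota_\Pi:\mathbb C[\Pi(n)_0]\to R_n$ the linear map sending a set partition to the product of its blocks. Let $NCP(n)_0\subseteq\Pi(n)_0$ be the noncrossing ones (no distinct blocks $B,B'$ with $a,c\in B$, $b,d\in B'$, $a<b<c<d$). A matching of $[n]$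 is a set of pairwise disjoint size-two subsets of $[n]$; let $NCM(n)$ be the set of noncrossing matchings (not containing $\{a,c\}$ and $\{b,d\}$ with $a<b<c<d$). Let $\varphi_n:\mathbb C[NCM(n)]\to M_n$ be the linear map sending a noncrossing matching to the product of its pairs. Let $f_n:\mathbb C[NCP(n)_0]\to\mathbb C[NCM(n)]$ be the linear map $f_n(\pi)=\sum_{m\in M_\pi(n)}m$, where $M_\pi(n)$ is the set of matchings consisting of exactly one pair inside each block of $\pi$ and no other pairs (these are noncrossing because $\pi$ is). Theorem. Let $H_n$ be the ideal of $M_n$ generated by $h_n([n])$. Then: 1. $h_n([n])=\sum_{a<b}\{a,b\}$ in $M_n$; 2. $\operatorname{im}(h_n\circ\iota_\Pi)=H_n$; 3. $\varphi_n$ is a linear isomorphism $\mathbb C[NCM(n)]\cong M_n$, and it carries the image of $f_n$ onto the ideal: $\varphi_n(\operatorname{im} f_n)=H_n$. -/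

import Mathlib

noncomputable section

namespace SkeinEmbedding

open Finset

/-- The nonempty subsets of `[n]` (modelled by `Fin n`). -/
abbrev NonemptySubset (n : ℕ) : Type := {A : Finset (Fin n) // A.Nonempty}

/-- The size-two subsets of `[n]`. -/
abbrev Pair (n : ℕ) : Type := {p : Finset (Fin n) // p.card = 2}

/-- The pair `{a, b}` of two distinct elements. -/
def pair {n : ℕ} (a b : Fin n) (h : a ≠ b) : Pair n :=
  ⟨{a, b}, Finset.card_pair h⟩

/-! ### The algebras `R_n`, `A_n`, `M_n` -/

/-- `R_n`: the free commutative unital `ℂ`-algebra on the nonempty subsets of `[n]`. -/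
abbrev R (n : ℕ) : Type := MvPolynomial (NonemptySubset n) ℂ

/-- The generator of `R_n` given by a nonempty subset of `[n]`. -/
def gen {n : ℕ} (A : NonemptySubset n) : R n := MvPolynomial.X A

/-- A size-two subset, as a nonempty subset. -/
def Pair.toNonemptySubset {n : ℕ} (p : Pair n) : NonemptySubset n :=
  ⟨p.1, Finset.card_pos.mp (by rw [p.2]; norm_num)⟩

/-- `A_n`: the subalgebra of `R_n` generated by the size-two subsets of `[n]`. -/
def A (n : ℕ) : Subalgebra ℂ (R n) :=
  Algebra.adjoin ℂ (Set.range fun p : Pair n => gen p.toNonemptySubset)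

/-- The generator of `A_n` given by a size-two subset of `[n]`. -/
def edge {n : ℕ} (p : Pair n) : A n :=
  ⟨gen p.toNonemptySubset, Algebra.subset_adjoin ⟨p, rfl⟩⟩

/-- The ideal `I_n` of `A_n`, generated by `{a,b}·{a,b}`, `{a,b}·{a,c}` and
`{a,b}·{c,d} + {a,c}·{b,d} + {a,d}·{b,c}` for distinct `a, b, c, d`. -/
def I (n : ℕ) : Ideal (A n) :=
  Ideal.span
    ({x | ∃ (a b : Fin n) (hab : a ≠ b),
        x = edge (pair a b hab) * edge (pair a b hab)} ∪
     {x | ∃ (a b c : Fin n) (hab : a ≠ b) (hac : a ≠ c) (_ : b ≠ c),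
        x = edge (pair a b hab) * edge (pair a c hac)} ∪
     {x | ∃ (a b c d : Fin n) (hab : a ≠ b) (hac : a ≠ c) (had : a ≠ d)
        (hbc : b ≠ c) (hbd : b ≠ d) (hcd : c ≠ d),
        x = edge (pair a b hab) * edge (pair c d hcd)
          + edge (pair a c hac) * edge (pair b d hbd)
          + edge (pair a d had) * edge (pair b c hbc)})

/-- `M_n = A_n / I_n`. -/
def M (n : ℕ) : Type := A n ⧸ I n

instance (n : ℕ) : CommRing (M n) := inferInstanceAs (CommRing (A n ⧸ I n))

instance (n : ℕ) : Algebra ℂ (M n) := inferInstanceAs (Algebra ℂ (A n ⧸ I n))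

/-- The quotient map `q : A_n → M_n`. -/
def q (n : ℕ) : A n →ₐ[ℂ] M n := Ideal.Quotient.mkₐ ℂ (I n)

/-- `g_n : R_n → A_n`, the algebra map sending a generator to the sum of the size-two subsets
that it contains. -/
def g (n : ℕ) : R n →ₐ[ℂ] A n :=
  MvPolynomial.aeval fun B : NonemptySubset n =>
    ∑ p ∈ (Finset.univ : Finset (Pair n)).filter (fun p => p.1 ⊆ B.1), edge p

/-- `h_n = q ∘ g_n : R_n → M_n`. -/
def h (n : ℕ) : R n →ₐ[ℂ] M n := (q n).comp (g n)

/-- The whole set `[n]`, a nonempty subset of `[n]` when `n ≠ 0`. -/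
def full (n : ℕ) [NeZero n] : NonemptySubset n := ⟨Finset.univ, Finset.univ_nonempty⟩

/-- `H_n`: the ideal of `M_n` generated by `h_n([n])`. -/
def H (n : ℕ) [NeZero n] : Ideal (M n) := Ideal.span {h n (gen (full n))}

/-! ### Matchings and set partitions -/

/-- Matchings of `[n]`: collections of pairwise disjoint size-two subsets. -/
abbrev Matching (n : ℕ) : Type :=
  {m : Finset (Pair n) // ∀ p ∈ m, ∀ p' ∈ m, p ≠ p' → Disjoint p.1 p'.1}

/-- A matching is noncrossing if it does not contain `{a, c}` and `{b, d}` with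
`a < b < c < d`. -/
def Matching.Noncrossing {n : ℕ} (m : Matching n) : Prop :=
  ¬ ∃ (a b c d : Fin n) (hab : a < b) (hbc : b < c) (hcd : c < d),
    pair a c (hab.trans hbc).ne ∈ m.1 ∧ pair b d (hbc.trans hcd).ne ∈ m.1

/-- `NCM(n)`: the noncrossing matchings of `[n]`. -/
abbrev NCM (n : ℕ) : Type := {m : Matching n // m.Noncrossing}

/-- `Π(n)`: the set partitions of `[n]`. -/
abbrev SetPartition (n : ℕ) : Type := Finpartition (Finset.univ : Finset (Fin n))

/-- A set partition is singleton-free if no block has exactly one element. -/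
def SingletonFree {n : ℕ} (π : SetPartition n) : Prop := ∀ B ∈ π.parts, B.card ≠ 1

/-- A set partition is noncrossing if there are no distinct blocks `B`, `B'` and elements
`a, c ∈ B`, `b, d ∈ B'` with `a < b < c < d`. -/
def NoncrossingPartition {n : ℕ} (π : SetPartition n) : Prop :=
  ¬ ∃ B ∈ π.parts, ∃ B' ∈ π.parts, B ≠ B' ∧
    ∃ a ∈ B, ∃ c ∈ B, ∃ b ∈ B', ∃ d ∈ B', a < b ∧ b < c ∧ c < d

/-- `Π(n)₀`: the singleton-free set partitions of `[n]`. -/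
abbrev SP₀ (n : ℕ) : Type := {π : SetPartition n // SingletonFree π}

/-- `NCP(n)₀`: the singleton-free noncrossing set partitions of `[n]`. -/
abbrev NCP₀ (n : ℕ) : Type := {π : SetPartition n // SingletonFree π ∧ NoncrossingPartition π}

/-- `M_π(n)`: the matchings of `[n]` that arise by picking exactly one pair inside each block
of `π` (and no other pairs). -/
def IsSelection {n : ℕ} (π : SetPartition n) (m : Matching n) : Prop :=
  (∀ p ∈ m.1, ∃ B ∈ π.parts, p.1 ⊆ B) ∧ ∀ B ∈ π.parts, ∃! p, p ∈ m.1 ∧ p.1 ⊆ B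

theorem IsSelection.noncrossing {n : ℕ} {π : SetPartition n} (hπ : NoncrossingPartition π)
    {m : Matching n} (hm : IsSelection π m) : m.Noncrossing := by
  rintro ⟨a, b, c, d, hab, hbc, hcd, h1, h2⟩
  obtain ⟨B, hB, hB1⟩ := hm.1 _ h1
  obtain ⟨B', hB', hB1'⟩ := hm.1 _ h2
  have haB : a ∈ B := hB1 (by simp [pair])
  have hcB : c ∈ B := hB1 (by simp [pair])
  have hbB : b ∈ B' := hB1' (by simp [pair])
  have hdB : d ∈ B' := hB1' (by simp [pair])
  by_cases hBB : B = B'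
  · subst hBB
    have heq := (hm.2 B hB).unique ⟨h1, hB1⟩ ⟨h2, hB1'⟩
    have ha : a ∈ (pair b d (hbc.trans hcd).ne).1 := by rw [← heq]; simp [pair]
    simp only [pair, Finset.mem_insert, Finset.mem_singleton] at ha
    rcases ha with ha | ha
    · exact hab.ne ha
    · exact (hab.trans (hbc.trans hcd)).ne ha
  · exact hπ ⟨B, hB, B', hB', hBB, a, haB, c, hcB, b, hbB, d, hdB, hab, hbc, hcd⟩

/-! ### The linear maps -/

/-- `ι_Π : ℂ[Π(n)₀] → R_n`, sending a singleton-free set partition to the product of its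
blocks. -/
def iota (n : ℕ) : (SP₀ n →₀ ℂ) →ₗ[ℂ] R n :=
  Finsupp.linearCombination ℂ fun π : SP₀ n =>
    ∏ B ∈ π.1.parts.attach, gen ⟨B.1, π.1.nonempty_of_mem_parts B.2⟩

/-- The linear map `ℂ[NCM(n)] → M_n` sending a noncrossing matching to the product of its
pairs. -/
def phi (n : ℕ) : (NCM n →₀ ℂ) →ₗ[ℂ] M n :=
  Finsupp.linearCombination ℂ fun m : NCM n => ∏ p ∈ m.1.1, q n (edge p)

open Classical in
/-- `f_n : ℂ[NCP(n)₀] → ℂ[NCM(n)]`, sending `π` to the sum of the matchings in `M_π(n)`. -/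
def f (n : ℕ) : (NCP₀ n →₀ ℂ) →ₗ[ℂ] (NCM n →₀ ℂ) :=
  Finsupp.linearCombination ℂ fun π : NCP₀ n =>
    ∑ m : {m : Matching n // IsSelection π.1 m},
      Finsupp.single (⟨m.1, m.2.noncrossing π.2.2⟩ : NCM n) (1 : ℂ)

end SkeinEmbedding

end

/-!
Write `s B` (`blockSum B`) for the sum in `M_n` of all pairs inside `B ⊆ [n]`, and `(B, C)`
(`arcSum B C`) for the sum of all `{a, b}` with `a ∈ B`, `b ∈ C`, where `{a, a} = 0`, so that
`(B, B) = 2 s B`. With this convention the Plücker-type relation holds for all `a, b, c, d` and so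
extends multilinearly to `(B, C) (D, E) + (B, D) (C, E) + (B, E) (C, D) = 0`. Both `h_n ∘ ι_Π` and
`φ_n ∘ f_n` send a set partition to the product of its `s B` (`h_iota_single`, `phi_f_single`).

Specializing the multilinear relation gives `s B * (B, C) = 0` and `s B * s B = 0`. Hence, for
disjoint blocks, `s B * s C = s (B ∪ C) * s C`, and the product of the block sums of a set
partition is `s [n]` times the product over all blocks but one (`blockSum_mul_prod`). So it lies in
`H_n`.

Conversely, `H_n` is spanned by the products of `s [n]` with noncrossing matchings `m`, and by the
same lemma `s [n]` may be replaced by `s U`, with `U` the set of points not covered by `m`. Now the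
identity `arc_mul_blockSum_union` rewrites an arc `{a, b}` of `m` times `s U` as a combination of
products of two block sums, each separating the part of `U` inside the arc from the part outside.
By induction on the number of arcs, this gives a combination of noncrossing partitions
(`blockSum_mul_matching_mem`). Partitions with a singleton block do no harm, since their product
vanishes.

Noncrossing matchings span `M_n` because uncrossing lowers the sum of the concave weights
`ℓ (2n - ℓ)` of the lengths `ℓ` of the arcs (`weight_uncross`). For their independence, `M_n` is
mapped to an exterior algebra by `{a, b} ↦ (u_a v_b - u_b v_a) ξ_a ξ_b` (`exists_algHom`). If `u`
and `v` are the indicators of the left and of the right end points of the arcs of a noncrossing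
matching `m₀`, then only matchings all of whose arcs join a left and a right end point of `m₀`
survive, and apart from `m₀` those have a smaller sum of left end points (`eq_of_openerSum_le`).
So the term with the least such sum in a linear relation has coefficient zero.
-/

noncomputable section

namespace SkeinEmbedding

open Finset

variable {n : ℕ}

/-! ### Arcs and block sums in `M_n` -/

/-- The class of a size-two subset in `M_n`. -/
def pairClass (p : Pair n) : M n := q n (edge p)

/-- The class of `{a, b}` in `M_n`, extended by `0` to `a = b`. With this convention the defining
relations of `M_n` hold without any distinctness assumption. -/
def arc (a b : Fin n) : M n := if hab : a ≠ b then pairClass (pair a b hab) else 0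

theorem pair_comm {a b : Fin n} (hab : a ≠ b) : pair a b hab = pair b a hab.symm :=
  Subtype.ext (Finset.pair_comm a b)

theorem arc_of_ne {a b : Fin n} (hab : a ≠ b) : arc a b = pairClass (pair a b hab) :=
  dif_pos hab

@[simp] theorem arc_self (a : Fin n) : arc a a = 0 := dif_neg (by simp)

theorem arc_comm (a b : Fin n) : arc a b = arc b a := by
  by_cases hab : a = b
  · rw [hab]
  · rw [arc_of_ne hab, arc_of_ne (Ne.symm hab), pair_comm]

theorem q_eq_zero {y : A n} (hy : y ∈ I n) : q n y = 0 :=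
  Ideal.Quotient.eq_zero_iff_mem.mpr hy

theorem arc_mul_arc_same (a b c : Fin n) : arc a b * arc a c = 0 := by
  by_cases hab : a = b
  · simp [← hab]
  by_cases hac : a = c
  · simp [← hac]
  rw [arc_of_ne hab, arc_of_ne hac, pairClass, pairClass, ← map_mul]
  refine q_eq_zero (Ideal.subset_span ?_)
  by_cases hbc : b = c
  · subst hbc
    exact Or.inl (Or.inl ⟨a, b, hab, rfl⟩)
  · exact Or.inl (Or.inr ⟨a, b, c, hab, hac, hbc, rfl⟩)

theorem arc_plucker (a b c d : Fin n) :
    arc a b * arc c d + arc a c * arc b d + arc a d * arc b c = 0 := by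
  by_cases hab : a = b
  · subst hab
    simp [arc_mul_arc_same]
  by_cases hac : a = c
  · subst hac
    simp [arc_mul_arc_same, arc_comm b a]
  by_cases had : a = d
  · subst had
    simp [arc_mul_arc_same, arc_comm b a, arc_comm c a]
  by_cases hbc : b = c
  · subst hbc
    simp [arc_mul_arc_same, arc_comm a b]
  by_cases hbd : b = d
  · subst hbd
    simp [arc_mul_arc_same, arc_comm a b, arc_comm c b]
  by_cases hcd : c = d
  · subst hcd
    simp [arc_mul_arc_same, arc_comm a c, arc_comm b c]
  simp only [arc_of_ne hab, arc_of_ne hac, arc_of_ne had, arc_of_ne hbc, arc_of_ne hbd,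
    arc_of_ne hcd, pairClass, ← map_mul, ← map_add]
  exact q_eq_zero (Ideal.subset_span (Or.inr ⟨a, b, c, d, hab, hac, had, hbc, hbd, hcd, rfl⟩))

/-- The sum of the classes `{a, b}` over `a ∈ B` and `b ∈ C`. -/
def arcSum (B C : Finset (Fin n)) : M n := ∑ a ∈ B, ∑ b ∈ C, arc a b

/-- The image of the generator `B` under `h_n`: the sum of all pairs inside `B`. It makes sense,
and vanishes, also for `B = ∅`. -/
def blockSum (B : Finset (Fin n)) : M n :=
  ∑ p ∈ (Finset.univ : Finset (Pair n)).filter (fun p => p.1 ⊆ B), pairClass p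

theorem h_gen (B : NonemptySubset n) : h n (gen B) = blockSum B.1 := by
  simp [h, g, gen, blockSum, pairClass]

theorem Pair.exists_lt (p : Pair n) : ∃ (a b : Fin n) (hab : a < b), p = pair a b hab.ne := by
  obtain ⟨a, b, hab, hp⟩ := Finset.card_eq_two.mp p.2
  rcases lt_or_gt_of_ne hab with hlt | hlt
  · exact ⟨a, b, hlt, Subtype.ext hp⟩
  · exact ⟨b, a, hlt, Subtype.ext (hp.trans (Finset.pair_comm a b))⟩

theorem pair_injective {a b c d : Fin n} (hab : a < b) (hcd : c < d)
    (heq : pair a b hab.ne = pair c d hcd.ne) : a = c ∧ b = d := by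
  have heq' : ({a, b} : Finset (Fin n)) = {c, d} := congrArg Subtype.val heq
  have h1 : a ∈ ({c, d} : Finset (Fin n)) := heq' ▸ by simp
  have h2 : b ∈ ({c, d} : Finset (Fin n)) := heq' ▸ by simp
  simp only [mem_insert, mem_singleton] at h1 h2
  omega

theorem blockSum_eq_sum_lt (B : Finset (Fin n)) :
    blockSum B = ∑ x ∈ (B ×ˢ B).filter (fun x => x.1 < x.2), arc x.1 x.2 := by
  symm
  refine Finset.sum_bij
    (fun x hx => pair x.1 x.2 (ne_of_lt (Finset.mem_filter.mp hx).2)) ?_ ?_ ?_ ?_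
  · intro x hx
    simp only [mem_filter, mem_product] at hx
    simp [pair, insert_subset_iff, hx.1]
  · intro x hx y hy hxy
    exact Prod.ext_iff.mpr (pair_injective (mem_filter.mp hx).2 (mem_filter.mp hy).2 hxy)
  · intro p hp
    obtain ⟨a, b, hab, rfl⟩ := p.exists_lt
    simp only [pair, mem_filter, mem_univ, true_and, insert_subset_iff,
      singleton_subset_iff] at hp
    exact ⟨(a, b), by simp [hp, hab], rfl⟩
  · intro x hx
    exact arc_of_ne _

theorem arcSum_self (B : Finset (Fin n)) : arcSum B B = 2 * blockSum B := by
  have key : ∀ x ∈ B ×ˢ B, arc x.1 x.2 =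
      (if x.1 < x.2 then arc x.1 x.2 else 0) + (if x.2 < x.1 then arc x.1 x.2 else 0) := by
    intro x _
    rcases lt_trichotomy x.1 x.2 with hlt | heq | hlt
    · simp [hlt, hlt.not_gt]
    · simp [heq]
    · simp [hlt, hlt.not_gt]
  have swap : ∑ x ∈ B ×ˢ B, (if x.2 < x.1 then arc x.1 x.2 else 0) =
      ∑ x ∈ B ×ˢ B, (if x.1 < x.2 then arc x.1 x.2 else 0) := by
    rw [Finset.sum_product, Finset.sum_product_right]
    refine Finset.sum_congr rfl fun a _ => Finset.sum_congr rfl fun b _ => ?_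
    rw [arc_comm]
  rw [arcSum, ← Finset.sum_product', Finset.sum_congr rfl key, Finset.sum_add_distrib, swap,
    ← Finset.sum_filter, ← blockSum_eq_sum_lt, two_mul]

theorem arcSum_comm (B C : Finset (Fin n)) : arcSum B C = arcSum C B := by
  rw [arcSum, Finset.sum_comm]
  exact Finset.sum_congr rfl fun b _ => Finset.sum_congr rfl fun a _ => arc_comm a b

theorem arcSum_union_left {B C : Finset (Fin n)} (hBC : Disjoint B C) (D : Finset (Fin n)) :
    arcSum (B ∪ C) D = arcSum B D + arcSum C D :=
  Finset.sum_union hBC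

theorem arcSum_union_right {B C : Finset (Fin n)} (hBC : Disjoint B C) (D : Finset (Fin n)) :
    arcSum D (B ∪ C) = arcSum D B + arcSum D C := by
  rw [arcSum_comm, arcSum_union_left hBC, arcSum_comm B, arcSum_comm C]

theorem arcSum_plucker (B C D E : Finset (Fin n)) :
    arcSum B C * arcSum D E + arcSum B D * arcSum C E + arcSum B E * arcSum C D = 0 := by
  have e1 : arcSum B C * arcSum D E =
      ∑ a ∈ B, ∑ b ∈ C, ∑ c ∈ D, ∑ d ∈ E, arc a b * arc c d := by
    simp only [arcSum, Finset.sum_mul]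
    simp only [Finset.mul_sum]
  have e2 : arcSum B D * arcSum C E =
      ∑ a ∈ B, ∑ b ∈ C, ∑ c ∈ D, ∑ d ∈ E, arc a c * arc b d := by
    simp only [arcSum, Finset.sum_mul]
    simp only [Finset.mul_sum]
    exact Finset.sum_congr rfl fun a _ => Finset.sum_comm
  have e3 : arcSum B E * arcSum C D =
      ∑ a ∈ B, ∑ b ∈ C, ∑ c ∈ D, ∑ d ∈ E, arc a d * arc b c := by
    simp only [arcSum, Finset.sum_mul]
    simp only [Finset.mul_sum]
    refine Finset.sum_congr rfl fun a _ => ?_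
    rw [Finset.sum_comm]
    exact Finset.sum_congr rfl fun b _ => Finset.sum_comm
  rw [e1, e2, e3]
  simp only [← Finset.sum_add_distrib, arc_plucker, Finset.sum_const_zero]

theorem eq_zero_of_ofNat_mul {k : ℕ} [k.AtLeastTwo] {y : M n}
    (hy : (OfNat.ofNat k : M n) * y = 0) : y = 0 := by
  have : (OfNat.ofNat k : ℂ) • y = 0 := by
    rw [Algebra.smul_def, map_ofNat, hy]
  exact (smul_eq_zero.mp this).resolve_left (OfNat.ofNat_ne_zero k)

/-- The case `B = C = D` of the Plücker relation reads `3 · (B, B) · (B, E) = 0`. -/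
theorem blockSum_mul_arcSum (B C : Finset (Fin n)) : blockSum B * arcSum B C = 0 := by
  have h1 := arcSum_plucker B B B C
  rw [arcSum_self] at h1
  refine eq_zero_of_ofNat_mul (k := 6) ?_
  linear_combination h1

theorem blockSum_mul_self (B : Finset (Fin n)) : blockSum B * blockSum B = 0 := by
  have h1 := blockSum_mul_arcSum B B
  rw [arcSum_self] at h1
  refine eq_zero_of_ofNat_mul (k := 2) ?_
  linear_combination h1

theorem blockSum_union {B C : Finset (Fin n)} (hBC : Disjoint B C) :
    blockSum (B ∪ C) = blockSum B + blockSum C + arcSum B C := by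
  have h1 := arcSum_self (B ∪ C)
  rw [arcSum_union_left hBC, arcSum_union_right hBC, arcSum_union_right hBC, arcSum_self,
    arcSum_self, arcSum_comm C B] at h1
  refine sub_eq_zero.mp (eq_zero_of_ofNat_mul (k := 2) ?_)
  linear_combination -h1

theorem blockSum_of_card_le_one {B : Finset (Fin n)} (hB : B.card ≤ 1) : blockSum B = 0 := by
  refine Finset.sum_eq_zero fun p hp => absurd (Finset.card_le_card (mem_filter.mp hp).2) ?_
  rw [p.2]
  omega

@[simp] theorem blockSum_empty : blockSum (∅ : Finset (Fin n)) = 0 :=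
  blockSum_of_card_le_one (by simp)

@[simp] theorem blockSum_singleton (a : Fin n) : blockSum ({a} : Finset (Fin n)) = 0 :=
  blockSum_of_card_le_one (by simp)

theorem blockSum_pair (p : Pair n) : blockSum p.1 = pairClass p := by
  have : (Finset.univ : Finset (Pair n)).filter (fun r => r.1 ⊆ p.1) = {p} := by
    ext r
    simp only [mem_filter, mem_univ, true_and, mem_singleton]
    exact ⟨fun hr => Subtype.ext (Finset.eq_of_subset_of_card_le hr (by rw [p.2, r.2])),
      fun hr => hr ▸ Subset.refl _⟩
  rw [blockSum, this, Finset.sum_singleton]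

/-- Blocks disjoint from `B` may be merged into `B` in the presence of their own block sums. -/
theorem blockSum_mul_prod (t : Finset (Finset (Fin n))) (B : Finset (Fin n))
    (hB : ∀ C ∈ t, Disjoint B C) (ht : (t : Set (Finset (Fin n))).PairwiseDisjoint id) :
    blockSum (B ∪ t.sup id) * ∏ C ∈ t, blockSum C = blockSum B * ∏ C ∈ t, blockSum C := by
  induction t using Finset.induction_on with
  | empty => simp
  | insert C t hC ih =>
    have ih' := ih (fun D hD => hB D (mem_insert_of_mem hD))
      (ht.subset (by simp))
    have hdisj : Disjoint (B ∪ t.sup id) C := by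
      rw [Finset.disjoint_union_left, Finset.disjoint_sup_left]
      refine ⟨hB C (mem_insert_self _ _), fun D hD => ?_⟩
      exact ht (by simp [hD]) (by simp) (fun heq => hC (heq ▸ hD))
    have h1 := blockSum_mul_arcSum C (B ∪ t.sup id)
    have h2 := blockSum_mul_self C
    rw [Finset.prod_insert hC, Finset.sup_insert, id, sup_eq_union, Finset.union_comm C,
      ← Finset.union_assoc, blockSum_union hdisj, arcSum_comm]
    linear_combination (blockSum C) * ih' + (∏ C ∈ t, blockSum C) * h1 +
      (∏ C ∈ t, blockSum C) * h2

/-- The uncrossing identity: an arc `{a, b}` times the block sum of a block with one part `P`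
"inside" and one part `Q` "outside" of the arc is a combination of products of two block sums,
each of which separates `P` from `Q`. -/
theorem arc_mul_blockSum_union {a b : Fin n} (hab : a ≠ b) {P Q : Finset (Fin n)}
    (haP : a ∉ P) (hbP : b ∉ P) (haQ : a ∉ Q) (hbQ : b ∉ Q) (hPQ : Disjoint P Q) :
    arc a b * blockSum (P ∪ Q) =
      blockSum ({a, b} ∪ P) * blockSum Q + blockSum P * blockSum ({a, b} ∪ Q)
        - blockSum ({a} ∪ P) * blockSum ({b} ∪ Q) - blockSum ({b} ∪ P) * blockSum ({a} ∪ Q) := by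
  have hx : arc a b = arcSum {a} {b} := by simp [arcSum]
  have habP : Disjoint {a} ({b} ∪ P) := by simp [hab, haP]
  have habQ : Disjoint {a} ({b} ∪ Q) := by simp [hab, haQ]
  have hb : Disjoint {b} P := by simpa using hbP
  have hb' : Disjoint {b} Q := by simpa using hbQ
  have ha : Disjoint {a} P := by simpa using haP
  have ha' : Disjoint {a} Q := by simpa using haQ
  rw [Finset.insert_eq, Finset.union_assoc, Finset.union_assoc, blockSum_union hPQ,
    blockSum_union habP, blockSum_union habQ, blockSum_union hb,
    blockSum_union hb', blockSum_union ha, blockSum_union ha', arcSum_union_right hb,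
    arcSum_union_right hb', hx]
  simp only [blockSum_singleton]
  have h1 := arcSum_plucker {a} {b} P Q
  linear_combination h1

/-! ### Spans of noncrossing partitions -/

/-- `P` is the set of blocks of a noncrossing set partition of `S ⊆ [n]`. -/
structure IsNCPartition (P : Finset (Finset (Fin n))) (S : Finset (Fin n)) : Prop where
  disjoint : ∀ B ∈ P, ∀ B' ∈ P, B ≠ B' → Disjoint B B'
  nonempty : ∀ B ∈ P, B.Nonempty
  sup_eq : P.sup id = S
  noncrossing : ∀ B ∈ P, ∀ B' ∈ P, B ≠ B' →
    ∀ a ∈ B, ∀ c ∈ B, ∀ b ∈ B', ∀ d ∈ B', a < b → b < c → ¬ c < d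

theorem IsNCPartition.subset {P : Finset (Finset (Fin n))} {S B : Finset (Fin n)}
    (hP : IsNCPartition P S) (hB : B ∈ P) : B ⊆ S :=
  hP.sup_eq ▸ Finset.le_sup (f := id) hB

/-- The span of the products of block sums over the noncrossing set partitions of `S`. Partitions
with singleton blocks are allowed, as they contribute `0`. -/
def ncSpan (S : Finset (Fin n)) : Submodule ℂ (M n) :=
  Submodule.span ℂ {y | ∃ P, IsNCPartition P S ∧ ∏ B ∈ P, blockSum B = y}

theorem blockSum_mem_ncSpan (S : Finset (Fin n)) : blockSum S ∈ ncSpan S := by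
  rcases S.eq_empty_or_nonempty with rfl | hS
  · simp
  · refine Submodule.subset_span ⟨{S}, ⟨?_, ?_, by simp, ?_⟩, by simp⟩
    · simp
    · simpa using hS
    · intro B hB B' hB' hne
      exact absurd ((mem_singleton.mp hB).trans (mem_singleton.mp hB').symm) hne

/-- If no element of `T` lies between two elements of `S`, then noncrossing partitions of `S` and
of `T` combine to a noncrossing partition of `S ∪ T`. -/
theorem IsNCPartition.union {P P' : Finset (Finset (Fin n))} {S T : Finset (Fin n)}
    (hP : IsNCPartition P S) (hP' : IsNCPartition P' T) (hST : Disjoint S T)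
    (hsep : ∀ x ∈ S, ∀ z ∈ S, ∀ y ∈ T, x < y → ¬ y < z) : IsNCPartition (P ∪ P') (S ∪ T) where
  disjoint := by
    intro B hB B' hB' hne
    rcases mem_union.mp hB with hB | hB <;> rcases mem_union.mp hB' with hB' | hB'
    · exact hP.disjoint B hB B' hB' hne
    · exact Disjoint.mono (hP.subset hB) (hP'.subset hB') hST
    · exact Disjoint.mono (hP'.subset hB) (hP.subset hB') hST.symm
    · exact hP'.disjoint B hB B' hB' hne
  nonempty := by
    intro B hB
    rcases mem_union.mp hB with hB | hB
    · exact hP.nonempty B hB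
    · exact hP'.nonempty B hB
  sup_eq := by rw [Finset.sup_union, hP.sup_eq, hP'.sup_eq, sup_eq_union]
  noncrossing := by
    intro B hB B' hB' hne a ha c hc b hb d hd hab hbc hcd
    rcases mem_union.mp hB with hB | hB <;> rcases mem_union.mp hB' with hB' | hB'
    · exact hP.noncrossing B hB B' hB' hne a ha c hc b hb d hd hab hbc hcd
    · exact hsep a (hP.subset hB ha) c (hP.subset hB hc) b (hP'.subset hB' hb) hab hbc
    · exact hsep b (hP.subset hB' hb) d (hP.subset hB' hd) c (hP'.subset hB hc) hbc hcd
    · exact hP'.noncrossing B hB B' hB' hne a ha c hc b hb d hd hab hbc hcd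

theorem mul_mem_ncSpan {S T : Finset (Fin n)} (hST : Disjoint S T)
    (hsep : ∀ x ∈ S, ∀ z ∈ S, ∀ y ∈ T, x < y → ¬ y < z) {u v : M n}
    (hu : u ∈ ncSpan S) (hv : v ∈ ncSpan T) : u * v ∈ ncSpan (S ∪ T) := by
  have hmul := Submodule.mul_mem_mul hu hv
  rw [ncSpan, ncSpan, Submodule.span_mul_span] at hmul
  refine Submodule.span_mono ?_ hmul
  rintro _ ⟨_, ⟨P, hP, rfl⟩, _, ⟨P', hP', rfl⟩, rfl⟩
  refine ⟨P ∪ P', hP.union hP' hST hsep, Finset.prod_union ?_⟩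
  rw [Finset.disjoint_left]
  intro B hB hB'
  obtain ⟨x, hx⟩ := hP.nonempty B hB
  exact Finset.disjoint_left.mp hST (hP.subset hB hx) (hP'.subset hB' hx)

/-- The set of points covered by a set of pairs. -/
def cover (m : Finset (Pair n)) : Finset (Fin n) := m.biUnion Subtype.val

theorem mem_cover {m : Finset (Pair n)} {i : Fin n} : i ∈ cover m ↔ ∃ p ∈ m, i ∈ p.1 :=
  Finset.mem_biUnion

theorem mem_pair {a b i : Fin n} (hab : a ≠ b) : i ∈ (pair a b hab).1 ↔ i = a ∨ i = b := by
  simp [pair]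

/-- In a noncrossing matching, an arc other than `{a, b}` lies strictly inside or strictly outside
of `{a, b}`. -/
theorem inside_or_outside {m : Matching n} (hm : m.Noncrossing) {a b : Fin n} (hab : a < b)
    (hp : pair a b hab.ne ∈ m.1) {r : Pair n} (hr : r ∈ m.1) (hne : r ≠ pair a b hab.ne) :
    (∀ i ∈ r.1, a < i ∧ i < b) ∨ ∀ i ∈ r.1, i < a ∨ b < i := by
  have hdisj := m.2 r hr _ hp hne
  obtain ⟨c, d, hcd, rfl⟩ := r.exists_lt
  have hc := Finset.disjoint_left.mp hdisj ((mem_pair _).mpr (Or.inl rfl))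
  have hd := Finset.disjoint_left.mp hdisj ((mem_pair _).mpr (Or.inr rfl))
  rw [mem_pair] at hc hd
  simp only [mem_pair, forall_eq_or_imp, forall_eq]
  have h1 : ¬ (a < c ∧ c < b ∧ b < d) := fun ⟨h1, h2, h3⟩ =>
    hm ⟨a, c, b, d, h1, h2, h3, hp, hr⟩
  have h2 : ¬ (c < a ∧ a < d ∧ d < b) := fun ⟨h1, h2, h3⟩ =>
    hm ⟨c, a, d, b, h1, h2, h3, hr, hp⟩
  omega

/-- A noncrossing matching times the block sum of a set of further points, which may well cross
the matching, is a combination of noncrossing partitions. An arc is removed by means of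
`arc_mul_blockSum_union`, and everything inside is separated from everything outside of it. -/
theorem blockSum_mul_matching_mem (m : Matching n) (hm : m.Noncrossing) (U : Finset (Fin n))
    (hU : Disjoint U (cover m.1)) :
    blockSum U * ∏ p ∈ m.1, pairClass p ∈ ncSpan (U ∪ cover m.1) := by
  induction hk : m.1.card using Nat.strong_induction_on generalizing m U with
  | _ k ih =>
  rcases m.1.eq_empty_or_nonempty with hm0 | ⟨p, hp⟩
  · simpa [hm0, cover] using blockSum_mem_ncSpan U
  obtain ⟨a, b, hab, rfl⟩ := p.exists_lt
  set p := pair a b hab.ne with hp_def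
  set inner : Pair n → Prop := fun r => ∀ i ∈ r.1, a < i ∧ i < b with hinner
  let m₁ := (m.1.erase p).filter inner
  let m₂ := (m.1.erase p).filter (fun r => ¬ inner r)
  let P := U.filter (fun i => a < i ∧ i < b)
  let Q := U.filter (fun i => ¬ (a < i ∧ i < b))
  have hsub₁ : m₁ ⊆ m.1.erase p := Finset.filter_subset _ _
  have hsub₂ : m₂ ⊆ m.1.erase p := Finset.filter_subset _ _
  have hcard : (m.1.erase p).card < k := hk ▸ Finset.card_erase_lt_of_mem hp
  have hin : ∀ i ∈ cover m₁, a < i ∧ i < b := by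
    intro i hi
    obtain ⟨r, hr, hir⟩ := mem_cover.mp hi
    exact (mem_filter.mp hr).2 i hir
  have hout : ∀ i ∈ cover m₂, i < a ∨ b < i := by
    intro i hi
    obtain ⟨r, hr, hir⟩ := mem_cover.mp hi
    have hr' := mem_erase.mp (hsub₂ hr)
    exact (inside_or_outside hm hab hp hr'.2 hr'.1).resolve_left (mem_filter.mp hr).2 i hir
  have hcov : cover m.1 = {a, b} ∪ (cover m₁ ∪ cover m₂) := by
    have h1 : m.1 = insert p (m₁ ∪ m₂) := by
      rw [Finset.filter_union_filter_not_eq, Finset.insert_erase hp]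
    rw [h1, cover, Finset.biUnion_insert, Finset.union_biUnion]
    rfl
  have haU : a ∉ U := fun ha => Finset.disjoint_left.mp hU ha (by simp [hcov])
  have hbU : b ∉ U := fun hb => Finset.disjoint_left.mp hU hb (by simp [hcov])
  have hU₁ : Disjoint U (cover m₁) := hU.mono_right (by rw [hcov]; intro i hi; simp [hi])
  have hU₂ : Disjoint U (cover m₂) := hU.mono_right (by rw [hcov]; intro i hi; simp [hi])
  have hPQ : P ∪ Q = U := Finset.filter_union_filter_not_eq _ _
  have sub_matching : ∀ m' ⊆ m.1.erase p, ∀ V : Finset (Fin n), Disjoint V (cover m') →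
      blockSum V * ∏ p ∈ m', pairClass p ∈ ncSpan (V ∪ cover m') := by
    intro m' hm' V hV
    have hm'' : m' ⊆ m.1 := hm'.trans (Finset.erase_subset _ _)
    refine ih m'.card ((Finset.card_le_card hm').trans_lt hcard)
      ⟨m', fun r hr r' hr' => m.2 r (hm'' hr) r' (hm'' hr')⟩ ?_ V hV rfl
    rintro ⟨x, y, z, w, hxy, hyz, hzw, h1, h2⟩
    exact hm ⟨x, y, z, w, hxy, hyz, hzw, hm'' h1, hm'' h2⟩
  -- every term of the uncrossing identity distributes `a` and `b` over the two sides of the arc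
  have term : ∀ K L : Finset (Fin n), Disjoint K L → K ∪ L = {a, b} →
      (blockSum (K ∪ P) * ∏ p ∈ m₁, pairClass p) * (blockSum (L ∪ Q) * ∏ p ∈ m₂, pairClass p)
        ∈ ncSpan (U ∪ cover m.1) := by
    intro K L hKL hKL'
    have hK : ∀ i ∈ K, i = a ∨ i = b := fun i hi => by
      simpa using (hKL' ▸ mem_union_left L hi : i ∈ ({a, b} : Finset (Fin n)))
    have hL : ∀ i ∈ L, i = a ∨ i = b := fun i hi => by
      simpa using (hKL' ▸ mem_union_right K hi : i ∈ ({a, b} : Finset (Fin n)))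
    have hS₁ : ∀ i ∈ K ∪ P ∪ cover m₁, i ∈ K ∨ a < i ∧ i < b := by
      intro i hi
      rcases mem_union.mp hi with hi | hi
      · rcases mem_union.mp hi with hi | hi
        · exact Or.inl hi
        · exact Or.inr (mem_filter.mp hi).2
      · exact Or.inr (hin i hi)
    have hS₂ : ∀ i ∈ L ∪ Q ∪ cover m₂, i ∈ L ∨ i < a ∨ b < i := by
      intro i hi
      rcases mem_union.mp hi with hi | hi
      · rcases mem_union.mp hi with hi | hi
        · exact Or.inl hi
        · have h1 := mem_filter.mp hi
          have h2 : i ≠ a := fun heq => haU (heq ▸ h1.1)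
          have h3 : i ≠ b := fun heq => hbU (heq ▸ h1.1)
          omega
      · exact Or.inr (hout i hi)
    have hS : U ∪ cover m.1 = (K ∪ P ∪ cover m₁) ∪ (L ∪ Q ∪ cover m₂) := by
      rw [hcov, ← hKL', ← hPQ]
      ext i
      simp only [mem_union]
      tauto
    rw [hS]
    refine mul_mem_ncSpan ?_ ?_ (sub_matching m₁ hsub₁ _ ?_) (sub_matching m₂ hsub₂ _ ?_)
    · rw [Finset.disjoint_left]
      intro i h1 h2
      rcases hS₁ i h1 with h3 | h3 <;> rcases hS₂ i h2 with h4 | h4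
      · exact Finset.disjoint_left.mp hKL h3 h4
      · have := hK i h3
        omega
      · have := hL i h4
        omega
      · omega
    · intro x hx z hz y hy
      have h1 : a ≤ x := by
        rcases hS₁ x hx with h3 | h3
        · have := hK x h3
          omega
        · omega
      have h2 : z ≤ b := by
        rcases hS₁ z hz with h3 | h3
        · have := hK z h3
          omega
        · omega
      rcases hS₂ y hy with h3 | h3
      · have := hL y h3
        omega
      · omega
    · rw [Finset.disjoint_union_left]
      refine ⟨?_, hU₁.mono_left (Finset.filter_subset _ _)⟩
      rw [Finset.disjoint_left]
      intro i h1 h2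
      have := hK i h1
      have := hin i h2
      omega
    · rw [Finset.disjoint_union_left]
      refine ⟨?_, hU₂.mono_left (Finset.filter_subset _ _)⟩
      rw [Finset.disjoint_left]
      intro i h1 h2
      have := hL i h1
      have := hout i h2
      omega
  have hdisj : Disjoint ({a} : Finset (Fin n)) {b} := by simpa using hab.ne
  have t1 := term {a, b} ∅ (by simp) (by simp)
  have t2 := term ∅ {a, b} (by simp) (by simp)
  have t3 := term {a} {b} hdisj rfl
  have t4 := term {b} {a} hdisj.symm (Finset.pair_comm b a)
  rw [Finset.empty_union] at t1 t2
  have huncross := arc_mul_blockSum_union hab.ne (P := P) (Q := Q) (by simp [P]) (by simp [P])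
    (fun ha => haU (mem_filter.mp ha).1) (fun hb => hbU (mem_filter.mp hb).1)
    (Finset.disjoint_filter_filter_not _ _ _)
  rw [hPQ, arc_of_ne hab.ne] at huncross
  have hprod : ∏ r ∈ m.1, pairClass r =
      pairClass p * ((∏ r ∈ m₁, pairClass r) * ∏ r ∈ m₂, pairClass r) := by
    rw [Finset.prod_filter_mul_prod_filter_not, Finset.mul_prod_erase _ _ hp]
  have heq : blockSum U * ∏ r ∈ m.1, pairClass r =
      (blockSum ({a, b} ∪ P) * ∏ p ∈ m₁, pairClass p) * (blockSum Q * ∏ p ∈ m₂, pairClass p)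
      + (blockSum P * ∏ p ∈ m₁, pairClass p) * (blockSum ({a, b} ∪ Q) * ∏ p ∈ m₂, pairClass p)
      - (blockSum ({a} ∪ P) * ∏ p ∈ m₁, pairClass p) *
          (blockSum ({b} ∪ Q) * ∏ p ∈ m₂, pairClass p)
      - (blockSum ({b} ∪ P) * ∏ p ∈ m₁, pairClass p) *
          (blockSum ({a} ∪ Q) * ∏ p ∈ m₂, pairClass p) := by
    rw [hprod]
    linear_combination ((∏ r ∈ m₁, pairClass r) * ∏ r ∈ m₂, pairClass r) * huncross
  rw [heq]
  exact Submodule.sub_mem _ (Submodule.sub_mem _ (Submodule.add_mem _ t1 t2) t3) t4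

/-! ### Products over the blocks of a partition -/

theorem pairwiseDisjoint_val (m : Matching n) :
    ((m.1.image Subtype.val : Finset (Finset (Fin n))) : Set (Finset (Fin n))).PairwiseDisjoint
      id := by
  intro B hB B' hB' hne
  simp only [coe_image, Set.mem_image, mem_coe] at hB hB'
  obtain ⟨p, hp, rfl⟩ := hB
  obtain ⟨p', hp', rfl⟩ := hB'
  exact m.2 p hp p' hp' fun heq => hne (heq ▸ rfl)

/-- The points covered by the matching may be removed from `univ`, by `blockSum_mul_prod` with the
arcs as blocks. -/
theorem blockSum_univ_mul_matching_mem (m : Matching n) (hm : m.Noncrossing) :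
    blockSum univ * ∏ p ∈ m.1, pairClass p ∈ ncSpan (univ : Finset (Fin n)) := by
  have hU : Disjoint (univ \ cover m.1) (cover m.1) := Finset.sdiff_disjoint
  have h1 := blockSum_mul_matching_mem m hm _ hU
  have h2 := blockSum_mul_prod (m.1.image Subtype.val) (univ \ cover m.1) ?_
    (pairwiseDisjoint_val m)
  · have h3 : (univ \ cover m.1) ∪ (m.1.image Subtype.val).sup id = univ := by
      rw [Finset.sup_image, Function.id_comp, Finset.sup_eq_biUnion]
      exact Finset.sdiff_union_of_subset (subset_univ _)
    rw [h3, Finset.prod_image Subtype.val_injective.injOn] at h2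
    simp only [blockSum_pair] at h2
    rw [h2]
    rwa [Finset.sdiff_union_of_subset (subset_univ _)] at h1
  · intro C hC
    obtain ⟨p, hp, rfl⟩ := mem_image.mp hC
    exact hU.mono_right fun i hi => mem_cover.mpr ⟨p, hp, hi⟩

/-- The product of all block sums but one, times `blockSum univ`, is the product of all block
sums. -/
theorem prod_blockSum_mem_H [NeZero n] (π : SetPartition n) :
    ∏ B ∈ π.parts, blockSum B ∈ H n := by
  obtain ⟨B, hB⟩ : π.parts.Nonempty :=
    π.parts_nonempty (Finset.univ_nonempty.ne_empty)
  have h1 := blockSum_mul_prod (π.parts.erase B) B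
    (fun C hC => π.disjoint hB (mem_of_mem_erase hC) (ne_of_mem_erase hC).symm)
    (π.disjoint.subset (by simp))
  have h2 : B ∪ (π.parts.erase B).sup id = univ := by
    have h3 := π.sup_parts
    rwa [← Finset.insert_erase hB, Finset.sup_insert] at h3
  rw [← Finset.mul_prod_erase _ _ hB, ← h1, h2, H, h_gen]
  exact Ideal.mul_mem_right _ _ (Ideal.subset_span rfl)

theorem h_iota_single (π : SP₀ n) :
    h n (iota n (Finsupp.single π 1)) = ∏ B ∈ π.1.parts, blockSum B := by
  rw [iota, Finsupp.linearCombination_single, one_smul, map_prod]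
  simp only [h_gen]
  exact Finset.prod_attach _ _

theorem phi_single (m : NCM n) : phi n (Finsupp.single m 1) = ∏ p ∈ m.1.1, pairClass p := by
  rw [phi, Finsupp.linearCombination_single, one_smul]
  rfl

/-- Expanding a product of block sums amounts to choosing a pair in each block. -/
theorem phi_f_single (π : NCP₀ n) :
    phi n (f n (Finsupp.single π 1)) = ∏ B ∈ π.1.parts, blockSum B := by
  classical
  rw [f, Finsupp.linearCombination_single, one_smul, map_sum]
  simp only [phi_single]
  have hpart : ∀ {B B' : Finset (Fin n)}, B ∈ π.1.parts → B' ∈ π.1.parts → ∀ {p : Pair n},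
      p.1 ⊆ B → p.1 ⊆ B' → B = B' := by
    intro B B' hB hB' p hp hp'
    obtain ⟨i, hi⟩ := p.toNonemptySubset.2
    exact π.1.eq_of_mem_parts hB hB' (hp hi) (hp' hi)
  simp only [blockSum]
  rw [Finset.prod_sum]
  symm
  have hmem : ∀ c ∈ π.1.parts.pi (fun B => (univ : Finset (Pair n)).filter (fun p => p.1 ⊆ B)),
      ∀ B (hB : B ∈ π.1.parts), (c B hB).1 ⊆ B := fun c hc B hB =>
    (mem_filter.mp (Finset.mem_pi.mp hc B hB)).2
  -- the set of pairs chosen by `c`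
  let sel := fun (c : (B : Finset (Fin n)) → B ∈ π.1.parts → Pair n) =>
    π.1.parts.attach.image (fun B => c B.1 B.2)
  have hinj : ∀ c ∈ π.1.parts.pi (fun B => (univ : Finset (Pair n)).filter (fun p => p.1 ⊆ B)),
      Function.Injective (fun B : π.1.parts => c B.1 B.2) := by
    intro c hc B B' heq
    refine Subtype.ext (hpart B.2 B'.2 (hmem c hc B.1 B.2) ?_)
    change c B.1 B.2 = c B'.1 B'.2 at heq
    rw [heq]
    exact hmem c hc B'.1 B'.2
  have hsel : ∀ c ∈ π.1.parts.pi (fun B => (univ : Finset (Pair n)).filter (fun p => p.1 ⊆ B)),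
      ∀ p, p ∈ sel c ↔ ∃ B, ∃ hB : B ∈ π.1.parts, c B hB = p := by
    intro c hc p
    simp [sel]
  refine Finset.sum_bij (fun c hc => ⟨⟨sel c, ?_⟩, ?_, ?_⟩) ?_ ?_ ?_ ?_
  · intro p hp p' hp' hne
    obtain ⟨B, hB, rfl⟩ := (hsel c hc p).mp hp
    obtain ⟨B', hB', rfl⟩ := (hsel c hc p').mp hp'
    refine Disjoint.mono (hmem c hc B hB) (hmem c hc B' hB') (π.1.disjoint hB hB' ?_)
    rintro rfl
    exact hne rfl
  · intro p hp
    obtain ⟨B, hB, rfl⟩ := (hsel c hc p).mp hp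
    exact ⟨B, hB, hmem c hc B hB⟩
  · intro B hB
    refine ⟨c B hB, ⟨(hsel c hc _).mpr ⟨B, hB, rfl⟩, hmem c hc B hB⟩, ?_⟩
    rintro p ⟨hp, hpB⟩
    obtain ⟨B', hB', rfl⟩ := (hsel c hc p).mp hp
    obtain rfl := hpart hB hB' hpB (hmem c hc B' hB')
    rfl
  · intro c hc
    exact mem_univ _
  · intro c hc c' hc' heq
    have heq' : sel c = sel c' := congrArg (fun x => x.1.1) heq
    funext B hB
    have h1 : c B hB ∈ sel c' := heq' ▸ (hsel c hc _).mpr ⟨B, hB, rfl⟩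
    obtain ⟨B', hB', h2⟩ := (hsel c' hc' _).mp h1
    obtain rfl := hpart hB hB' (hmem c hc B hB) (h2 ▸ hmem c' hc' B' hB')
    exact h2.symm
  · intro m _
    choose c hc using fun B hB => (m.2.2 B hB).exists
    have hcpi : c ∈ π.1.parts.pi
        (fun B => (univ : Finset (Pair n)).filter (fun p => p.1 ⊆ B)) :=
      Finset.mem_pi.mpr fun B hB => mem_filter.mpr ⟨mem_univ _, (hc B hB).2⟩
    refine ⟨c, hcpi, Subtype.ext (Subtype.ext ?_)⟩
    ext p
    refine (hsel c hcpi p).trans ⟨?_, ?_⟩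
    · rintro ⟨B, hB, rfl⟩
      exact (hc B hB).1
    · intro hp
      obtain ⟨B, hB, hpB⟩ := m.2.1 p hp
      exact ⟨B, hB, (m.2.2 B hB).unique (hc B hB) ⟨hp, hpB⟩⟩
  · intro c hc
    exact (Finset.prod_image (hinj c hc).injOn).symm

theorem ncSpan_univ_le :
    ncSpan (univ : Finset (Fin n)) ≤ (LinearMap.range (f n)).map (phi n) := by
  refine Submodule.span_le.mpr ?_
  rintro _ ⟨P, hP, rfl⟩
  by_cases hsing : ∃ B ∈ P, B.card = 1
  · obtain ⟨B, hB, hcard⟩ := hsing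
    rw [Finset.prod_eq_zero hB (blockSum_of_card_le_one hcard.le)]
    exact Submodule.zero_mem _
  · push Not at hsing
    let π : SetPartition n :=
      { parts := P
        supIndep := Finset.supIndep_iff_pairwiseDisjoint.mpr fun B hB B' hB' hne =>
          hP.disjoint B hB B' hB' hne
        sup_parts := hP.sup_eq
        bot_notMem := fun hbot => (hP.nonempty _ hbot).ne_empty rfl }
    have hπ : NoncrossingPartition π := by
      rintro ⟨B, hB, B', hB', hne, a, ha, c, hc, b, hb, d, hd, hab, hbc, hcd⟩
      exact hP.noncrossing B hB B' hB' hne a ha c hc b hb d hd hab hbc hcd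
    exact ⟨_, ⟨Finsupp.single ⟨π, hsing, hπ⟩ 1, rfl⟩, phi_f_single _⟩

/-! ### Noncrossing matchings span `M_n` -/

theorem pairClass_mul_of_not_disjoint {p p' : Pair n} (hp : ¬ Disjoint p.1 p'.1) :
    pairClass p * pairClass p' = 0 := by
  have key : ∀ (r : Pair n) (i : Fin n), i ∈ r.1 → ∃ j, pairClass r = arc i j := by
    intro r i hi
    obtain ⟨a, b, hab, rfl⟩ := r.exists_lt
    rcases (mem_pair _).mp hi with rfl | rfl
    · exact ⟨b, (arc_of_ne hab.ne).symm⟩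
    · exact ⟨a, by rw [arc_comm, arc_of_ne hab.ne]⟩
  obtain ⟨i, hi, hi'⟩ := Finset.not_disjoint_iff.mp hp
  obtain ⟨j, hj⟩ := key p i hi
  obtain ⟨k, hk⟩ := key p' i hi'
  rw [hj, hk, arc_mul_arc_same]

theorem pairClass_mul_prod (p : Pair n) (m : Finset (Pair n)) :
    pairClass p * ∏ r ∈ m, pairClass r =
      if p ∈ m then 0 else ∏ r ∈ insert p m, pairClass r := by
  split_ifs with hp
  · rw [← Finset.mul_prod_erase _ _ hp, ← mul_assoc, pairClass_mul_of_not_disjoint, zero_mul]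
    rw [disjoint_self, Finset.bot_eq_empty, ← Finset.card_eq_zero, p.2]
    norm_num
  · rw [Finset.prod_insert hp]

theorem span_prod_pairClass :
    Submodule.span ℂ (Set.range fun m : Finset (Pair n) => ∏ r ∈ m, pairClass r) = ⊤ := by
  set N := Submodule.span ℂ (Set.range fun m : Finset (Pair n) => ∏ r ∈ m, pairClass r)
  have hmul : ∀ (p : Pair n), ∀ y ∈ N, pairClass p * y ∈ N := by
    intro p y hy
    induction hy using Submodule.span_induction with
    | mem y hy =>
      obtain ⟨m, rfl⟩ := hy
      simp only [pairClass_mul_prod]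
      split_ifs
      · exact Submodule.zero_mem _
      · exact Submodule.subset_span ⟨_, rfl⟩
    | zero => simp
    | add y z _ _ hy hz => simpa [mul_add] using Submodule.add_mem _ hy hz
    | smul c y _ hy => simpa using Submodule.smul_mem _ c hy
  have hone : (1 : M n) ∈ N := Submodule.subset_span ⟨∅, by simp⟩
  have key : ∀ y : A n, ∀ z ∈ N, q n y * z ∈ N := by
    rintro ⟨y, hy⟩
    induction hy using Algebra.adjoin_induction with
    | mem y hy =>
      obtain ⟨p, rfl⟩ := hy
      exact hmul p
    | algebraMap c =>
      intro z hz
      have : q n ⟨algebraMap ℂ (R n) c, (A n).algebraMap_mem c⟩ = algebraMap ℂ (M n) c :=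
        (q n).commutes c
      rw [this, ← Algebra.smul_def]
      exact Submodule.smul_mem _ c hz
    | add y y' hy hy' h1 h2 =>
      intro z hz
      have hyy' : (⟨y + y', (A n).add_mem hy hy'⟩ : A n) = ⟨y, hy⟩ + ⟨y', hy'⟩ := rfl
      have : q n ⟨y + y', (A n).add_mem hy hy'⟩ = q n ⟨y, hy⟩ + q n ⟨y', hy'⟩ := by
        rw [hyy', map_add]
      rw [this, add_mul]
      exact Submodule.add_mem _ (h1 z hz) (h2 z hz)
    | mul y y' hy hy' h1 h2 =>
      intro z hz
      have hyy' : (⟨y * y', (A n).mul_mem hy hy'⟩ : A n) = ⟨y, hy⟩ * ⟨y', hy'⟩ := rfl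
      have : q n ⟨y * y', (A n).mul_mem hy hy'⟩ = q n ⟨y, hy⟩ * q n ⟨y', hy'⟩ := by
        rw [hyy', map_mul]
      rw [this, mul_assoc]
      exact h1 _ (h2 z hz)
  rw [eq_top_iff]
  intro y _
  obtain ⟨y, rfl⟩ : ∃ y', q n y' = y := Ideal.Quotient.mk_surjective y
  simpa using key y 1 hone

/-- A weight on pairs that drops under uncrossing: it is `ℓ (2n - ℓ)` for the pair `{a, b}` with
`ℓ = |a - b|`, a strictly increasing and strictly concave function of `ℓ ≤ n`. -/
def weight (p : Pair n) : ℕ :=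
  ∑ x ∈ (p.1 ×ˢ p.1).filter (fun x => x.1 < x.2),
    (x.2.val - x.1.val) * (2 * n - (x.2.val - x.1.val))

theorem weight_pair {a b : Fin n} (hab : a < b) :
    weight (pair a b hab.ne) = (b.val - a.val) * (2 * n - (b.val - a.val)) := by
  have : ((pair a b hab.ne).1 ×ˢ (pair a b hab.ne).1).filter (fun x => x.1 < x.2) = {(a, b)} := by
    ext ⟨i, j⟩
    simp only [mem_filter, mem_product, mem_pair, mem_singleton, Prod.mk.injEq]
    omega
  rw [weight, this, Finset.sum_singleton]

theorem weight_uncross {a b c d : Fin n} (hab : a < b) (hbc : b < c) (hcd : c < d) :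
    weight (pair a b hab.ne) + weight (pair c d hcd.ne) <
        weight (pair a c (hab.trans hbc).ne) + weight (pair b d (hbc.trans hcd).ne) ∧
      weight (pair a d (hab.trans (hbc.trans hcd)).ne) + weight (pair b c hbc.ne) <
        weight (pair a c (hab.trans hbc).ne) + weight (pair b d (hbc.trans hcd).ne) := by
  simp only [weight_pair, hab, hbc, hcd, hab.trans hbc, hbc.trans hcd,
    hab.trans (hbc.trans hcd)]
  obtain ⟨x, hx⟩ : ∃ x, b.val = a.val + (x + 1) := ⟨b - a - 1, by omega⟩
  obtain ⟨y, hy⟩ : ∃ y, c.val = b.val + (y + 1) := ⟨c - b - 1, by omega⟩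
  obtain ⟨z, hz⟩ : ∃ z, d.val = c.val + (z + 1) := ⟨d - c - 1, by omega⟩
  obtain ⟨w, hw⟩ : ∃ w, n = x + 1 + (y + 1) + (z + 1) + w :=
    ⟨n - (x + 1 + (y + 1) + (z + 1)), by omega⟩
  have e1 : b.val - a.val = x + 1 := by omega
  have e2 : d.val - c.val = z + 1 := by omega
  have e3 : c.val - a.val = x + y + 2 := by omega
  have e4 : d.val - b.val = y + z + 2 := by omega
  have e5 : d.val - a.val = x + y + z + 3 := by omega
  have e6 : c.val - b.val = y + 1 := by omega
  have f1 : 2 * n - (x + 1) = x + 2 * y + 2 * z + 2 * w + 5 := by omega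
  have f2 : 2 * n - (z + 1) = 2 * x + 2 * y + z + 2 * w + 5 := by omega
  have f3 : 2 * n - (x + y + 2) = x + y + 2 * z + 2 * w + 4 := by omega
  have f4 : 2 * n - (y + z + 2) = 2 * x + y + z + 2 * w + 4 := by omega
  have f5 : 2 * n - (x + y + z + 3) = x + y + z + 2 * w + 3 := by omega
  have f6 : 2 * n - (y + 1) = 2 * x + y + 2 * z + 2 * w + 5 := by omega
  rw [e1, e2, e3, e4, e5, e6, f1, f2, f3, f4, f5, f6]
  constructor
  · ring_nf
    omega
  · ring_nf
    omega

theorem prod_pairClass_mem_range (m : Finset (Pair n)) :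
    ∏ r ∈ m, pairClass r ∈ LinearMap.range (phi n) := by
  induction hk : ∑ r ∈ m, weight r using Nat.strong_induction_on generalizing m with
  | _ k ih =>
  by_cases hmatch : ∀ p ∈ m, ∀ p' ∈ m, p ≠ p' → Disjoint p.1 p'.1
  swap
  · push Not at hmatch
    obtain ⟨p, hp, p', hp', hne, hdisj⟩ := hmatch
    rw [← Finset.mul_prod_erase _ _ hp, ← Finset.mul_prod_erase _ _ (mem_erase.mpr ⟨hne.symm, hp'⟩),
      ← mul_assoc, pairClass_mul_of_not_disjoint hdisj, zero_mul]
    exact Submodule.zero_mem _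
  by_cases hnc : Matching.Noncrossing ⟨m, hmatch⟩
  · exact ⟨_, phi_single ⟨⟨m, hmatch⟩, hnc⟩⟩
  rw [Matching.Noncrossing, not_not] at hnc
  obtain ⟨a, b, c, d, hab, hbc, hcd, hac, hbd⟩ := hnc
  have hne : pair b d (hbc.trans hcd).ne ≠ pair a c (hab.trans hbc).ne := fun heq =>
    hab.ne' (pair_injective (hbc.trans hcd) (hab.trans hbc) heq).1
  have hbd' := mem_erase.mpr ⟨hne, hbd⟩
  set m' := (m.erase (pair a c (hab.trans hbc).ne)).erase (pair b d (hbc.trans hcd).ne)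
  have hw : weight (pair a c (hab.trans hbc).ne) + (weight (pair b d (hbc.trans hcd).ne) +
      ∑ r ∈ m', weight r) = k := by
    rw [Finset.add_sum_erase _ _ hbd', Finset.add_sum_erase _ _ hac, hk]
  have hprod : pairClass (pair a c (hab.trans hbc).ne) * (pairClass (pair b d (hbc.trans hcd).ne) *
      ∏ r ∈ m', pairClass r) = ∏ r ∈ m, pairClass r := by
    rw [Finset.mul_prod_erase _ _ hbd', Finset.mul_prod_erase _ _ hac]
  have key : ∀ p p' : Pair n, weight p + weight p' + ∑ r ∈ m', weight r < k →
      pairClass p * (pairClass p' * ∏ r ∈ m', pairClass r) ∈ LinearMap.range (phi n) := by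
    intro p p' hlt
    rw [pairClass_mul_prod]
    split_ifs with hp'
    · rw [mul_zero]
      exact Submodule.zero_mem _
    rw [pairClass_mul_prod]
    split_ifs with hp
    · exact Submodule.zero_mem _
    refine ih _ ?_ _ rfl
    rw [Finset.sum_insert hp, Finset.sum_insert hp']
    omega
  obtain ⟨hw1, hw2⟩ := weight_uncross hab hbc hcd
  have h1 := key (pair a b hab.ne) (pair c d hcd.ne) (by omega)
  have h2 := key (pair a d (hab.trans (hbc.trans hcd)).ne) (pair b c hbc.ne) (by omega)
  have hpl := arc_plucker a b c d
  rw [arc_of_ne hab.ne, arc_of_ne hcd.ne, arc_of_ne (hab.trans hbc).ne,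
    arc_of_ne (hbc.trans hcd).ne, arc_of_ne (hab.trans (hbc.trans hcd)).ne,
    arc_of_ne hbc.ne] at hpl
  have heq : ∏ r ∈ m, pairClass r =
      -(pairClass (pair a b hab.ne) * (pairClass (pair c d hcd.ne) * ∏ r ∈ m', pairClass r)) -
      pairClass (pair a d (hab.trans (hbc.trans hcd)).ne) *
        (pairClass (pair b c hbc.ne) * ∏ r ∈ m', pairClass r) := by
    rw [← hprod]
    linear_combination (∏ r ∈ m', pairClass r) * hpl
  rw [heq]
  exact Submodule.sub_mem _ (Submodule.neg_mem _ h1) h2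

theorem phi_surjective : Function.Surjective (phi n) := by
  rw [← LinearMap.range_eq_top, eq_top_iff, ← span_prod_pairClass, Submodule.span_le]
  rintro _ ⟨m, rfl⟩
  exact prod_pairClass_mem_range m

/-! ### The ideal `H_n` -/

theorem map_range_f_le :
    (LinearMap.range (f n)).map (phi n) ≤
      LinearMap.range ((h n).toLinearMap ∘ₗ iota n) := by
  rw [← LinearMap.range_comp, LinearMap.range_le_iff_comap, eq_top_iff]
  intro c _
  induction c using Finsupp.induction_linear with
  | zero => exact Submodule.zero_mem _
  | add c c' hc hc' => exact Submodule.add_mem _ (hc trivial) (hc' trivial)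
  | single π c =>
    refine ⟨Finsupp.single ⟨π.1, π.2.1⟩ c, ?_⟩
    rw [← mul_one c, ← smul_eq_mul, ← Finsupp.smul_single, ← Finsupp.smul_single, map_smul,
      map_smul]
    exact congrArg (c • ·) ((h_iota_single _).trans (phi_f_single π).symm)

theorem range_h_iota_le [NeZero n] :
    LinearMap.range ((h n).toLinearMap ∘ₗ iota n) ≤ (H n).restrictScalars ℂ := by
  rw [LinearMap.range_le_iff_comap, eq_top_iff]
  intro c _
  induction c using Finsupp.induction_linear with
  | zero => exact Submodule.zero_mem _
  | add c c' hc hc' => exact Submodule.add_mem _ (hc trivial) (hc' trivial)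
  | single π c =>
    rw [← mul_one c, ← smul_eq_mul, ← Finsupp.smul_single]
    refine Submodule.smul_mem _ c ?_
    change h n (iota n (Finsupp.single π 1)) ∈ H n
    rw [h_iota_single]
    exact prod_blockSum_mem_H π.1

theorem H_le_map_range_f [NeZero n] :
    (H n).restrictScalars ℂ ≤ (LinearMap.range (f n)).map (phi n) := by
  refine le_trans ?_ ncSpan_univ_le
  intro y hy
  obtain ⟨z, rfl⟩ := Ideal.mem_span_singleton'.mp hy
  obtain ⟨c, rfl⟩ := phi_surjective z
  rw [mul_comm, h_gen]
  induction c using Finsupp.induction_linear with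
  | zero => simp
  | add c c' hc hc' =>
    rw [map_add, mul_add]
    exact Submodule.add_mem _ (hc (Ideal.mul_mem_left _ _ (Ideal.subset_span rfl)))
      (hc' (Ideal.mul_mem_left _ _ (Ideal.subset_span rfl)))
  | single m c =>
    rw [← mul_one c, ← smul_eq_mul c 1, ← Finsupp.smul_single, map_smul, phi_single,
      mul_smul_comm]
    exact Submodule.smul_mem _ c (blockSum_univ_mul_matching_mem m.1 m.2)

/-! ### Openers and closers of a noncrossing matching -/

/-- The smaller element of a pair. -/
def Pair.lo (p : Pair n) : Fin n := p.1.min' p.toNonemptySubset.2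

/-- The larger element of a pair. -/
def Pair.hi (p : Pair n) : Fin n := p.1.max' p.toNonemptySubset.2

theorem lo_pair {a b : Fin n} (hab : a < b) : (pair a b hab.ne).lo = a := by
  simp [Pair.lo, pair, hab.le]

theorem hi_pair {a b : Fin n} (hab : a < b) : (pair a b hab.ne).hi = b := by
  simp [Pair.hi, pair, hab.le]

theorem Pair.lo_lt_hi (p : Pair n) : p.lo < p.hi := by
  obtain ⟨a, b, hab, rfl⟩ := p.exists_lt
  rwa [lo_pair hab, hi_pair hab]

theorem Pair.eq_pair (p : Pair n) : p = pair p.lo p.hi p.lo_lt_hi.ne := by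
  obtain ⟨a, b, hab, rfl⟩ := p.exists_lt
  simp only [lo_pair hab, hi_pair hab]

theorem Pair.lo_mem (p : Pair n) : p.lo ∈ p.1 := Finset.min'_mem _ _

theorem Pair.hi_mem (p : Pair n) : p.hi ∈ p.1 := Finset.max'_mem _ _

theorem Matching.eq_of_mem (m : Matching n) {p p' : Pair n} (hp : p ∈ m.1) (hp' : p' ∈ m.1)
    {i : Fin n} (hi : i ∈ p.1) (hi' : i ∈ p'.1) : p = p' := by
  by_contra hne
  exact Finset.disjoint_left.mp (m.2 p hp p' hp' hne) hi hi'

/-- The set of left end points of a matching. -/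
def openers (m : Matching n) : Finset (Fin n) := m.1.image Pair.lo

/-- The set of right end points of a matching. -/
def closers (m : Matching n) : Finset (Fin n) := m.1.image Pair.hi

theorem lo_injOn (m : Matching n) : Set.InjOn Pair.lo (m.1 : Set (Pair n)) :=
  fun p hp p' hp' heq => m.eq_of_mem hp hp' p.lo_mem (heq ▸ p'.lo_mem)

theorem hi_injOn (m : Matching n) : Set.InjOn Pair.hi (m.1 : Set (Pair n)) :=
  fun p hp p' hp' heq => m.eq_of_mem hp hp' p.hi_mem (heq ▸ p'.hi_mem)

theorem disjoint_openers_closers (m : Matching n) : Disjoint (openers m) (closers m) := by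
  rw [Finset.disjoint_left]
  intro i ho hc
  obtain ⟨p, hp, rfl⟩ := mem_image.mp ho
  obtain ⟨p', hp', heq⟩ := mem_image.mp hc
  obtain rfl := m.eq_of_mem hp hp' p.lo_mem (heq ▸ p'.hi_mem)
  exact p.lo_lt_hi.ne' heq

/-- If the arc `p` of `m` is not in `m'`, then the arcs of `m'` at the end points of `p` are longer
than `p`, because all shorter arcs are shared with `m`. Hence they cross. -/
theorem mem_of_mem_of_shorter {m m' : Matching n} (hm' : m'.Noncrossing)
    (ho : openers m = openers m') (hc : closers m = closers m') {p : Pair n} (hp : p ∈ m.1)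
    (hshort : ∀ r ∈ m'.1, r.hi.val - r.lo.val < p.hi.val - p.lo.val → r ∈ m.1) : p ∈ m'.1 := by
  by_contra hp'
  obtain ⟨r, hr, hrlo⟩ := mem_image.mp (ho ▸ mem_image_of_mem _ hp : p.lo ∈ openers m')
  obtain ⟨t, ht, hthi⟩ := mem_image.mp (hc ▸ mem_image_of_mem _ hp : p.hi ∈ closers m')
  have hrp : r ∉ m.1 := fun hrm =>
    hp' (m.eq_of_mem hrm hp r.lo_mem (hrlo ▸ p.lo_mem) ▸ hr)
  have htp : t ∉ m.1 := fun htm =>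
    hp' (m.eq_of_mem htm hp t.hi_mem (hthi ▸ p.hi_mem) ▸ ht)
  have h1 : ¬ (r.hi.val - r.lo.val < p.hi.val - p.lo.val) := fun hlt => hrp (hshort r hr hlt)
  have h2 : ¬ (t.hi.val - t.lo.val < p.hi.val - p.lo.val) := fun hlt => htp (hshort t ht hlt)
  have h3 : r.hi ≠ p.hi := fun heq => hp' (by
    rw [p.eq_pair]
    simp only [← heq, ← hrlo]
    rwa [← r.eq_pair])
  have h4 : t.lo ≠ p.lo := fun heq => hp' (by
    rw [p.eq_pair]
    simp only [← heq, ← hthi]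
    rwa [← t.eq_pair])
  have hplt := p.lo_lt_hi
  have hrlt := r.lo_lt_hi
  have htlt := t.lo_lt_hi
  refine hm' ⟨t.lo, r.lo, t.hi, r.hi, by omega, by omega, by omega, ?_, ?_⟩
  · rwa [← t.eq_pair]
  · rwa [← r.eq_pair]

theorem eq_of_openers_of_closers {m m' : Matching n} (hm : m.Noncrossing) (hm' : m'.Noncrossing)
    (ho : openers m = openers m') (hc : closers m = closers m') : m = m' := by
  have key : ∀ k, ∀ p : Pair n, p.hi.val - p.lo.val = k → (p ∈ m.1 ↔ p ∈ m'.1) := by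
    intro k
    induction k using Nat.strong_induction_on with
    | _ k ih =>
    intro p hk
    exact ⟨fun hp => mem_of_mem_of_shorter hm' ho hc hp
        fun r hr hlt => (ih _ (hk ▸ hlt) r rfl).mpr hr,
      fun hp => mem_of_mem_of_shorter hm ho.symm hc.symm hp
        fun r hr hlt => (ih _ (hk ▸ hlt) r rfl).mp hr⟩
  exact Subtype.ext (Finset.ext fun p => key _ p rfl)

/-- The sum of the positions of the openers of a matching. Positions are counted from one, so that
dropping an opener lowers the sum. -/
def openerSum (m : Matching n) : ℕ := ∑ p ∈ m.1, (p.lo.val + 1)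

theorem openerSum_eq (m : Matching n) : openerSum m = ∑ i ∈ openers m, (i.val + 1) :=
  (Finset.sum_image (f := fun i : Fin n => i.val + 1) (lo_injOn m)).symm

/-- A matching each of whose arcs joins an opener and a closer of `m₀` has at most the opener sum
of `m₀`, with equality only for `m₀` itself. -/
theorem eq_of_openerSum_le {m m₀ : Matching n} (hm : m.Noncrossing) (hm₀ : m₀.Noncrossing)
    (hjoin : ∀ p ∈ m.1, p.lo ∈ openers m₀ ∧ p.hi ∈ closers m₀ ∨
      p.hi ∈ openers m₀ ∧ p.lo ∈ closers m₀)
    (hle : openerSum m₀ ≤ openerSum m) : m = m₀ := by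
  classical
  -- the end point of `p` that is an opener of `m₀`
  let o : Pair n → Fin n := fun p => if p.lo ∈ openers m₀ then p.lo else p.hi
  have ho_mem : ∀ p : Pair n, o p ∈ p.1 := by
    intro p
    simp only [o]
    split_ifs
    · exact p.lo_mem
    · exact p.hi_mem
  have ho_inj : Set.InjOn o (m.1 : Set (Pair n)) := fun p hp p' hp' heq =>
    m.eq_of_mem hp hp' (ho_mem p) (heq ▸ ho_mem p')
  have ho_sub : m.1.image o ⊆ openers m₀ := by
    intro i hi
    obtain ⟨p, hp, rfl⟩ := mem_image.mp hi
    simp only [o]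
    split_ifs with hlo
    · exact hlo
    · exact ((hjoin p hp).resolve_left fun hl => hlo hl.1).1
  have ho_le : ∀ p ∈ m.1, p.lo.val + 1 ≤ (o p).val + 1 := by
    intro p _
    have := p.lo_lt_hi
    simp only [o]
    split_ifs <;> omega
  have h1 : openerSum m ≤ ∑ p ∈ m.1, ((o p).val + 1) := Finset.sum_le_sum ho_le
  have h2 : ∑ p ∈ m.1, ((o p).val + 1) = ∑ i ∈ m.1.image o, (i.val + 1) :=
    (Finset.sum_image (f := fun i : Fin n => i.val + 1) ho_inj).symm
  have h3 : ∑ i ∈ m.1.image o, (i.val + 1) ≤ ∑ i ∈ openers m₀, (i.val + 1) :=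
    Finset.sum_le_sum_of_subset ho_sub
  have h4 := openerSum_eq m₀
  have hlo : ∀ p ∈ m.1, p.lo = o p := by
    intro p hp
    have := (Finset.sum_eq_sum_iff_of_le ho_le).mp
      (show openerSum m = _ by omega) p hp
    omega
  have himage : m.1.image o = openers m₀ := by
    by_contra hne
    obtain ⟨i, hi, hi'⟩ := Finset.exists_of_ssubset (ho_sub.ssubset_of_ne hne)
    have := Finset.sum_lt_sum_of_subset (f := fun i : Fin n => i.val + 1) ho_sub hi hi'
      (Nat.succ_pos _) (fun _ _ _ => Nat.zero_le _)
    omega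
  have hop : openers m = openers m₀ := by
    rw [← himage]
    exact Finset.image_congr fun p hp => hlo p hp
  have hcl_sub : closers m ⊆ closers m₀ := by
    intro i hi
    obtain ⟨p, hp, rfl⟩ := mem_image.mp hi
    refine ((hjoin p hp).resolve_right fun hr => ?_).2
    have : p.lo ∈ openers m₀ := hop ▸ mem_image_of_mem _ hp
    exact Finset.disjoint_left.mp (disjoint_openers_closers m₀) this hr.2
  refine eq_of_openers_of_closers hm hm₀ hop (Finset.eq_of_subset_of_card_le hcl_sub ?_)
  have h5 : (openers m).card = (openers m₀).card := by rw [hop]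
  rw [openers, openers, Finset.card_image_of_injOn (lo_injOn m),
    Finset.card_image_of_injOn (lo_injOn m₀)] at h5
  rw [closers, closers, Finset.card_image_of_injOn (hi_injOn m),
    Finset.card_image_of_injOn (hi_injOn m₀), h5]

/-! ### A model of `M_n` in an exterior algebra -/

/-- The standard generator `ξ_i` of the exterior algebra of `ℂ^n`. -/
def xi (i : Fin n) : ExteriorAlgebra ℂ (Fin n → ℂ) := ExteriorAlgebra.ι ℂ (Pi.single i 1)

theorem xi_mul_self (i : Fin n) : xi i * xi i = 0 := ExteriorAlgebra.ι_sq_zero _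

theorem xi_mul_swap (i j : Fin n) : xi i * xi j = -(xi j * xi i) :=
  eq_neg_of_add_eq_zero_left (ExteriorAlgebra.ι_add_mul_swap _ _)

theorem xi_mul_xi_commute (a b c d : Fin n) :
    xi a * xi b * (xi c * xi d) = xi c * xi d * (xi a * xi b) := by
  calc xi a * xi b * (xi c * xi d) = xi a * (xi b * xi c) * xi d := by noncomm_ring
    _ = -(xi a * xi c * (xi b * xi d)) := by rw [xi_mul_swap b c]; noncomm_ring
    _ = -(xi c * (xi a * xi d) * xi b) := by
      rw [xi_mul_swap a c, xi_mul_swap b d]; noncomm_ring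
    _ = xi c * xi d * (xi a * xi b) := by
      rw [xi_mul_swap a d]; noncomm_ring

/-- The pairing with the corresponding coordinate forms is the determinant of the identity
matrix. -/
theorem prod_xi_ne_zero {l : List (Fin n)} (hl : l.Nodup) : (l.map xi).prod ≠ 0 := by
  intro hzero
  have h1 : ExteriorAlgebra.ιMulti ℂ l.length (fun k => Pi.single (M := fun _ => ℂ) (l.get k) 1) =
      0 := by
    rw [ExteriorAlgebra.ιMulti_apply, ← hzero]
    congr 1
    conv_rhs => rw [← List.ofFn_get l, List.map_ofFn]
    rfl
  have h2 : exteriorPower.ιMulti ℂ l.length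
      (fun k => Pi.single (M := fun _ => ℂ) (l.get k) 1) = 0 := Subtype.ext h1
  have h3 := exteriorPower.pairingDual_ιMulti_ιMulti (R := ℂ)
    (fun k : Fin l.length => LinearMap.proj (φ := fun _ : Fin n => ℂ) (l.get k))
    (fun k => Pi.single (M := fun _ => ℂ) (l.get k) 1)
  rw [h2, map_zero] at h3
  have h4 : (Matrix.of fun i j : Fin l.length =>
      LinearMap.proj (R := ℂ) (φ := fun _ : Fin n => ℂ) (l.get j)
        (Pi.single (M := fun _ => ℂ) (l.get i) (1 : ℂ))) = 1 := by
    ext i j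
    have hinj : l.get j = l.get i ↔ i = j :=
      ⟨fun heq => (List.nodup_iff_injective_get.mp hl heq).symm, fun heq => heq ▸ rfl⟩
    simp only [Matrix.of_apply, LinearMap.proj_apply, Pi.single_apply, Matrix.one_apply, hinj]
  rw [h4, Matrix.det_one] at h3
  exact zero_ne_one h3

/-- The element `(u_a v_b - u_b v_a) ξ_a ξ_b` of the exterior algebra attached to a pair
`{a, b}`. Both factors change sign when `a` and `b` are exchanged. -/
def wedge (u v : Fin n → ℂ) (p : Pair n) : ExteriorAlgebra ℂ (Fin n → ℂ) :=
  (u p.lo * v p.hi - u p.hi * v p.lo) • (xi p.lo * xi p.hi)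

theorem wedge_pair (u v : Fin n → ℂ) {a b : Fin n} (hab : a ≠ b) :
    wedge u v (pair a b hab) = (u a * v b - u b * v a) • (xi a * xi b) := by
  rcases lt_or_gt_of_ne hab with hlt | hlt
  · rw [wedge, lo_pair hlt, hi_pair hlt]
  · rw [pair_comm, wedge, lo_pair hlt, hi_pair hlt, xi_mul_swap b a, smul_neg, ← neg_smul]
    congr 1
    ring

theorem wedge_commute (u v : Fin n → ℂ) (p p' : Pair n) :
    wedge u v p * wedge u v p' = wedge u v p' * wedge u v p := by
  rw [wedge, wedge, smul_mul_smul_comm, smul_mul_smul_comm, xi_mul_xi_commute, mul_comm (_ - _)]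

theorem wedge_mul_same (u v : Fin n → ℂ) {a b c : Fin n} (hab : a ≠ b) (hac : a ≠ c) :
    wedge u v (pair a b hab) * wedge u v (pair a c hac) = 0 := by
  have : xi a * xi b * (xi a * xi c) = 0 := by
    rw [xi_mul_swap a b]
    calc -(xi b * xi a) * (xi a * xi c) = -(xi b * (xi a * xi a) * xi c) := by noncomm_ring
      _ = 0 := by rw [xi_mul_self]; simp
  rw [wedge_pair, wedge_pair, smul_mul_smul_comm, this, smul_zero]

theorem wedge_plucker (u v : Fin n → ℂ) {a b c d : Fin n} (hab : a ≠ b) (hac : a ≠ c)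
    (had : a ≠ d) (hbc : b ≠ c) (hbd : b ≠ d) (hcd : c ≠ d) :
    wedge u v (pair a b hab) * wedge u v (pair c d hcd) +
      wedge u v (pair a c hac) * wedge u v (pair b d hbd) +
      wedge u v (pair a d had) * wedge u v (pair b c hbc) = 0 := by
  have h1 : xi a * xi c * (xi b * xi d) = -(xi a * xi b * (xi c * xi d)) := by
    calc xi a * xi c * (xi b * xi d) = xi a * (xi c * xi b) * xi d := by noncomm_ring
      _ = _ := by rw [xi_mul_swap c b]; noncomm_ring
  have h2 : xi a * xi d * (xi b * xi c) = xi a * xi b * (xi c * xi d) := by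
    calc xi a * xi d * (xi b * xi c) = xi a * (xi d * (xi b * xi c)) := by noncomm_ring
      _ = xi a * (xi b * xi c * xi d) := by
        rw [← mul_assoc (xi d), xi_mul_swap d b, neg_mul, mul_assoc, xi_mul_swap d c]
        noncomm_ring
      _ = _ := by noncomm_ring
  simp only [wedge_pair, smul_mul_smul_comm, h1, h2, smul_neg, ← neg_smul, ← add_smul]
  convert zero_smul ℂ _
  ring

open scoped IsMulCommutative in
/-- The assignment `{a, b} ↦ (u_a v_b - u_b v_a) ξ_a ξ_b` extends to `M_n`: the sign of
`ξ_a ξ_b ξ_c ξ_d` under permutations turns the Plücker relation of the minors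
`u_a v_b - u_b v_a` into the defining relation of `M_n`. -/
theorem exists_algHom (u v : Fin n → ℂ) :
    ∃ Ψ : M n →ₐ[ℂ] ExteriorAlgebra ℂ (Fin n → ℂ), ∀ p, Ψ (pairClass p) = wedge u v p := by
  let E := Algebra.adjoin ℂ (Set.range (wedge u v))
  have : IsMulCommutative E := Algebra.isMulCommutative_adjoin ℂ (by
    rintro _ ⟨p, rfl⟩ _ ⟨p', rfl⟩
    exact wedge_commute u v p p')
  let w : NonemptySubset n → E := fun B =>
    if hB : B.1.card = 2 then ⟨wedge u v ⟨B.1, hB⟩, Algebra.subset_adjoin ⟨_, rfl⟩⟩ else 0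
  let F : A n →ₐ[ℂ] ExteriorAlgebra ℂ (Fin n → ℂ) :=
    (E.val.comp (MvPolynomial.aeval w)).comp (A n).val
  have hF : ∀ p, F (edge p) = wedge u v p := by
    intro p
    have h1 : F (edge p) = (w p.toNonemptySubset : ExteriorAlgebra ℂ (Fin n → ℂ)) :=
      congrArg Subtype.val (MvPolynomial.aeval_X w p.toNonemptySubset)
    have h2 : p.toNonemptySubset.1.card = 2 := p.2
    rw [h1]
    simp only [w, dif_pos h2]
    rfl
  have hI : ∀ y ∈ I n, F y = 0 := by
    intro y hy
    refine Submodule.span_induction ?_ (map_zero F) (fun y z _ _ h1 h2 => ?_)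
      (fun c y _ h1 => ?_) hy
    · rintro y ((⟨a, b, hab, rfl⟩ | ⟨a, b, c, hab, hac, _, rfl⟩) |
        ⟨a, b, c, d, hab, hac, had, hbc, hbd, hcd, rfl⟩)
      · rw [map_mul, hF, wedge_mul_same]
      · rw [map_mul, hF, hF, wedge_mul_same]
      · rw [map_add, map_add, map_mul, map_mul, map_mul, hF, hF, hF, hF, hF, hF, wedge_plucker]
    · rw [map_add, h1, h2, add_zero]
    · rw [smul_eq_mul, map_mul, h1, mul_zero]
  exact ⟨Ideal.Quotient.liftₐ (I n) F hI, hF⟩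

/-! ### Noncrossing matchings are linearly independent in `M_n` -/

theorem algHom_prod {u v : Fin n → ℂ} {Ψ : M n →ₐ[ℂ] ExteriorAlgebra ℂ (Fin n → ℂ)}
    (hΨ : ∀ p, Ψ (pairClass p) = wedge u v p) (m : Finset (Pair n)) :
    Ψ (∏ p ∈ m, pairClass p) = (m.toList.map (wedge u v)).prod := by
  rw [← Finset.prod_map_toList, map_list_prod, List.map_map]
  congr 2
  exact funext hΨ

theorem prod_wedge (u v : Fin n → ℂ) (l : List (Pair n))
    (hl : ∀ p ∈ l, u p.lo * v p.hi - u p.hi * v p.lo = 1) :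
    (l.map (wedge u v)).prod = ((l.flatMap fun p => [p.lo, p.hi]).map xi).prod := by
  induction l with
  | nil => simp
  | cons p l ih =>
    rw [List.map_cons, List.prod_cons, ih fun r hr => hl r (List.mem_cons_of_mem _ hr), wedge,
      hl p List.mem_cons_self, one_smul]
    simp [mul_assoc]

theorem nodup_flatMap_ends (m : Matching n) :
    (m.1.toList.flatMap fun p => [p.lo, p.hi]).Nodup := by
  refine List.nodup_flatMap.mpr ⟨fun p _ => by simp [p.lo_lt_hi.ne], ?_⟩
  refine List.Pairwise.imp_of_mem ?_ m.1.nodup_toList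
  intro p p' hp hp' hne
  have hdisj := Finset.disjoint_left.mp (m.2 p' (mem_toList.mp hp') p (mem_toList.mp hp) hne.symm)
  have h1 := hdisj p'.lo_mem
  have h2 := hdisj p'.hi_mem
  rw [p.eq_pair, mem_pair, not_or] at h1 h2
  simp [Function.onFun, h1, h2]

theorem phi_injective : Function.Injective (phi n) := by
  classical
  rw [injective_iff_map_eq_zero]
  intro c hc
  by_contra hne
  -- the matching with the least opener sum in the relation is the only one that survives in the
  -- model attached to its own openers and closers
  obtain ⟨m₀, hm₀, hmin⟩ := Finset.exists_min_image c.support (fun m => openerSum m.1)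
    (Finsupp.support_nonempty_iff.mpr hne)
  let u : Fin n → ℂ := fun i => if i ∈ openers m₀.1 then 1 else 0
  let v : Fin n → ℂ := fun i => if i ∈ closers m₀.1 then 1 else 0
  obtain ⟨Ψ, hΨ⟩ := exists_algHom u v
  have hother : ∀ m ∈ c.support, m ≠ m₀ → Ψ (∏ p ∈ m.1.1, pairClass p) = 0 := by
    intro m hm hmne
    by_contra hzero
    refine hmne (Subtype.ext (eq_of_openerSum_le m.2 m₀.2 ?_ (hmin m hm)))
    intro p hp
    by_contra hp'
    refine hzero ?_
    have hcoef : u p.lo * v p.hi - u p.hi * v p.lo = 0 := by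
      rw [not_or, not_and_or, not_and_or] at hp'
      rcases hp' with ⟨h1 | h1, h2 | h2⟩ <;> simp [u, v, h1, h2]
    rw [← Finset.mul_prod_erase _ _ hp, map_mul, hΨ, wedge, hcoef, zero_smul, zero_mul]
  have hself : Ψ (∏ p ∈ m₀.1.1, pairClass p) ≠ 0 := by
    rw [algHom_prod hΨ, prod_wedge]
    · exact prod_xi_ne_zero (nodup_flatMap_ends m₀.1)
    · intro p hp
      have h1 : p.lo ∈ openers m₀.1 := mem_image_of_mem _ (mem_toList.mp hp)
      have h2 : p.hi ∈ closers m₀.1 := mem_image_of_mem _ (mem_toList.mp hp)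
      have h3 := Finset.disjoint_left.mp (disjoint_openers_closers m₀.1) h1
      simp [u, v, h1, h2, h3]
  have hsum : Ψ (phi n c) = c m₀ • Ψ (∏ p ∈ m₀.1.1, pairClass p) := by
    rw [phi, Finsupp.linearCombination_apply, Finsupp.sum, map_sum,
      Finset.sum_eq_single_of_mem m₀ hm₀]
    · exact map_smul Ψ _ _
    · intro m hm hmne
      rw [map_smul]
      exact (congrArg (c m • ·) (hother m hm hmne)).trans (smul_zero _)
  rw [hc, map_zero] at hsum
  exact (smul_ne_zero (Finsupp.mem_support_iff.mp hm₀) hself) hsum.symm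

end SkeinEmbedding

theorem mainTheorem2 (n : ℕ) [NeZero n] :
    -- the generator of `H_n` is the sum of all pairs `{a, b}` with `a < b`
    SkeinEmbedding.h n (SkeinEmbedding.gen (SkeinEmbedding.full n)) =
        ∑ x : {x : Fin n × Fin n // x.1 < x.2},
          SkeinEmbedding.q n (SkeinEmbedding.edge (SkeinEmbedding.pair x.1.1 x.1.2 x.2.ne)) ∧
    -- the image of `h_n` on (products of blocks of) singleton-free set partitions is `H_n`
    LinearMap.range ((SkeinEmbedding.h n).toLinearMap ∘ₗ SkeinEmbedding.iota n) =
        (SkeinEmbedding.H n).restrictScalars ℂ ∧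
    -- under the identification of `ℂ[NCM(n)]` with `M_n`, the image of `f_n` is `H_n`
    Function.Bijective (SkeinEmbedding.phi n) ∧
    (LinearMap.range (SkeinEmbedding.f n)).map (SkeinEmbedding.phi n) =
        (SkeinEmbedding.H n).restrictScalars ℂ := by
  refine ⟨?_, le_antisymm SkeinEmbedding.range_h_iota_le
      (SkeinEmbedding.H_le_map_range_f.trans SkeinEmbedding.map_range_f_le),
    ⟨SkeinEmbedding.phi_injective, SkeinEmbedding.phi_surjective⟩,
    le_antisymm (SkeinEmbedding.map_range_f_le.trans SkeinEmbedding.range_h_iota_le)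
      SkeinEmbedding.H_le_map_range_f⟩
  rw [SkeinEmbedding.h_gen, SkeinEmbedding.blockSum_eq_sum_lt,
    Finset.sum_subtype (p := fun x : Fin n × Fin n => x.1 < x.2) _
      (fun x => by simp [SkeinEmbedding.full])]
  exact Finset.sum_congr rfl fun x _ => SkeinEmbedding.arc_of_ne x.2.ne

end
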